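/- **Definitions.** A function $f:\mathbb R\to\mathbb R$ is bi-Lipschitz with constants $(c_1,c_2)$, $c_1>0$, if $c_1|x-y|\le |f(x)-f(y)|\le c_2|x-y|$ for all $x,y\in\mathbb R$. For a compact set $C\subset\mathbb R$ with convex hull $I_C$, let $(G_n)$ be the connected components of $I_C\setminus C$ (the gaps), listed by decreasing length (ties in any order, for instance from left to right). Let $I_n$ be the connected component of $I_C\setminus(G_1\cup\dots\cup G_{n-1})$ containing $G_n$, and let $L_n,R_n$ be the left and right components of $I_n\setminus G_n$. The (Newhouse) thickness of $C$ is $$\tau(C)=\inf_n \frac{\min\{|L_n|,|R_n|\}}{|G_n|}\in[0,\infty],$$ with $\tau(C)=0$ if $C$ is a singleton and $\tau(C)=\infty$ if $C$ is a nondegenerate interval. **Statement.** Let $A\ge 1$, $D>0$, $m>0$, $\lambda>0$ and $t\in\mathbb R$. Let $\mathcal F$ be a family of bi-Lipschitz functions $f:\mathbb R\to\mathbb R$ with constants $(c_1(f),c_2(f))$ such that $\frac{c_2(f)}{c_1(f)}\le A$ and $\lambda\, c_1(f)^{-1}\le D$ for all $f\in\mathcal F$, and suppose that $I$ is a closed interval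 of length $m$ contained in $\bigcap_{f\in\mathcal F}f^{-1}([t,t+\lambda])$. Put $\beta:=\min\{\frac mD,\frac1{4A}\}$ and $$N(\tau):=\left\lfloor \frac{\tau\beta}{720^2\, e\, A^{1-\frac1{\log(\tau\beta)}}}\left(1-\beta^{\frac1{\log(\tau\beta)}}\right)\right\rfloor,\qquad N(\infty):=\infty .$$ Let $C\subset\mathbb R$ be a compact set with convex hull $[t,t+\lambda]$ and with $\tau(C)\,\beta\ge e$. Then, for every subfamily $\mathcal F_0\subseteq\mathcal F$ with at most $N(\tau(C))$ elements, $$\dim_{\rm H}\Big(I\cap\bigcap_{f\in\mathcal F_0}f^{-1}\big((-\infty,t)\cup C\cup(t+\lambda,\infty)\big)\Big)>0 .$$ (For $N(\tau(C))=\infty$ the subfamily $\mathcal F_0$ is arbitrary; an empty intersection of preimages is $\mathbb R$.) -/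

import Mathlib

open scoped ENNReal
open MeasureTheory

/-- `(a, b)` is a bounded complementary interval (a gap) of the compact set `C ⊆ ℝ`:
a bounded connected component of `ℝ \ C`. -/
def IsGap (C : Set ℝ) (a b : ℝ) : Prop :=
  a < b ∧ a ∈ C ∧ b ∈ C ∧ Disjoint (Set.Ioo a b) C

/-- The union of the gaps `G_k` of `C` that come before the gap `(a, b)` when the gaps are listed
by decreasing length, gaps of equal length being listed from left to right. -/
def earlierGaps (C : Set ℝ) (a b : ℝ) : Set ℝ :=
  {x | ∃ a' b' : ℝ, IsGap C a' b' ∧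
    (b - a < b' - a' ∨ (b' - a' = b - a ∧ a' < a)) ∧ x ∈ Set.Ioo a' b'}

/-- The closed interval from which the gap `(a, b)` is removed: the connected component containing
`(a, b)` of the convex hull of `C` minus the gaps removed before `(a, b)`. -/
def parentInterval (C : Set ℝ) (a b : ℝ) : Set ℝ :=
  connectedComponentIn (convexHull ℝ C \ earlierGaps C a b) ((a + b) / 2)

/-- The left piece of `parentInterval C a b \ (a, b)`. -/
def leftPiece (C : Set ℝ) (a b : ℝ) : Set ℝ := parentInterval C a b ∩ Set.Iic a

/-- The right piece of `parentInterval C a b \ (a, b)`. -/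
def rightPiece (C : Set ℝ) (a b : ℝ) : Set ℝ := parentInterval C a b ∩ Set.Ici b

open Classical in
/-- The Newhouse thickness of a compact set `C ⊆ ℝ`: the infimum over all gaps `G` of
`min (|L|, |R|) / |G|`. It is `0` for a singleton, and `∞` for a nondegenerate interval (the
infimum over no gaps). -/
noncomputable def thickness (C : Set ℝ) : ℝ≥0∞ :=
  if C.Subsingleton then 0
  else ⨅ (a : ℝ) (b : ℝ) (_ : IsGap C a b),
    min (volume (leftPiece C a b)) (volume (rightPiece C a b)) / volume (Set.Ioo a b)

/-- `f : ℝ → ℝ` is bi-Lipschitz with constants `(c₁, c₂)`. -/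
def IsBiLipschitz (c₁ c₂ : ℝ) (f : ℝ → ℝ) : Prop :=
  0 < c₁ ∧ ∀ x y : ℝ, c₁ * |x - y| ≤ |f x - f y| ∧ |f x - f y| ≤ c₂ * |x - y|

/-- The parameter `β = min {m / D, 1 / (4 A)}`. -/
noncomputable def betaParam (A D m : ℝ) : ℝ := min (m / D) (1 / (4 * A))

open Classical in
/-- The number `N(τ)`, with `N(∞) = ∞` (the limit of `N(τ)` as `τ → ∞`). -/
noncomputable def patternBound (A β : ℝ) (τ : ℝ≥0∞) : ℕ∞ :=
  if τ = ∞ then ⊤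
  else ((⌊τ.toReal * β / (720 ^ 2 * Real.exp 1 * A ^ (1 - 1 / Real.log (τ.toReal * β))) *
    (1 - β ^ (1 / Real.log (τ.toReal * β)))⌋₊ : ℕ) : ℕ∞)

/-! Pull the gaps of `C` back by every `f ∈ F₀`. A point of the given interval that avoids all these
open intervals is in the target set, so only their sizes and positions matter. Thickness forces two
gaps of `C` to be at least `τ` times the shorter one apart (`IsGap.thickness_mul_min_le`). A
bi-Lipschitz map with `c₂ / c₁ ≤ A` weakens this to `θ = τ / A` for the intervals of one `f`
(`EndsSeparated`), and every interval has length at most `m / (τβ)`.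

Subdivide `[a, a + m]` in base 4. Give a cell of length `l` the potential `∑ (|g| / l) ^ (1 - δ)`,
summed over the endpoints in it of intervals `g` with `θ|g| > l`. Among the four children, the old
intervals contribute `4 ^ (1 - δ)` times the parent potential in total. Separation allows at most
one new interval per `f` in each child, with ratio at most `4 / θ`. The average potential thus
contracts by `4 ^ (-δ)` up to a small error (`EndsSeparated.sum_gapPotential_le`).

Such a contraction leaves a branching tree of cells of potential at most `η`
(`dimH_pos_of_potential`), whose limit set has positive dimension. A limit point lies in no interval
`g`: a cell around it slightly longer than `g` would have potential at least `1/4 > η = 1/8`. The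
choice `δ = 1 / log (τβ)` makes the definition of `N(τ)` give the required bounds
(`patternBound_estimates`). -/

/-! ### Branching trees of grid cells and Hausdorff dimension. -/

/-- The `i`-th cell of level `k` in the base `M` subdivision of `[a, a + m]`. -/
def gridCell (M : ℕ) (a m : ℝ) (k i : ℕ) : Set ℝ :=
  Set.Icc (a + i * (m / (M : ℝ) ^ k)) (a + (i + 1) * (m / (M : ℝ) ^ k))

lemma gridCell_succ_subset {M : ℕ} (hM : 0 < M) {a m : ℝ} (hm : 0 ≤ m) (k j : ℕ) :
    gridCell M a m (k + 1) j ⊆ gridCell M a m k (j / M) := by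
  have hM' : (0 : ℝ) < M := by exact_mod_cast hM
  have hl : 0 ≤ m / (M : ℝ) ^ (k + 1) := by positivity
  have hk : m / (M : ℝ) ^ k = M * (m / (M : ℝ) ^ (k + 1)) := by
    rw [pow_succ]; field_simp
  have h1 : ((j / M : ℕ) : ℝ) * M ≤ j := by exact_mod_cast Nat.div_mul_le_self j M
  have h2 : (j : ℝ) + 1 ≤ ((j / M : ℕ) + 1) * M := by
    exact_mod_cast Nat.lt_mul_of_div_lt (Nat.lt_succ_self _) hM
  apply Set.Icc_subset_Icc
  · rw [hk]
    nlinarith [mul_le_mul_of_nonneg_right h1 hl]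
  · rw [hk]
    nlinarith [mul_le_mul_of_nonneg_right h2 hl]

/-- The index of the level `k` cell reached along the binary branch `s`, when the children of the
cell `(k, i)` are `(k + 1, p k i)` and `(k + 1, q k i)`. -/
def branchIndex (p q : ℕ → ℕ → ℕ) (s : ℕ → Fin 2) : ℕ → ℕ
  | 0 => 0
  | k + 1 => if s k = 0 then p k (branchIndex p q s k) else q k (branchIndex p q s k)

lemma branchIndex_congr (p q : ℕ → ℕ → ℕ) {s s' : ℕ → Fin 2} {k : ℕ}
    (h : ∀ i < k, s i = s' i) : branchIndex p q s k = branchIndex p q s' k := by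
  induction k with
  | zero => rfl
  | succ k ih =>
    simp only [branchIndex, h k (Nat.lt_succ_self k), ih fun i hi => h i (hi.trans (Nat.lt_succ_self k))]

/-- A set of reals coded by binary sequences, such that codes which differ first at `k` give points
at distance at least `m / M ^ (k + 1)`, has positive Hausdorff dimension. -/
lemma dimH_range_pos_of_separated {M : ℕ} (hM : 2 ≤ M) {m : ℝ} (hm : 0 < m)
    (x : (ℕ → Fin 2) → ℝ)
    (hx : ∀ s s' k, (∀ i < k, s i = s' i) → s k ≠ s' k → m / (M : ℝ) ^ (k + 1) ≤ |x s - x s'|) :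
    0 < dimH (Set.range x) := by
  classical
  have hM1 : (1 : ℝ) < M := by exact_mod_cast hM
  have hM0 : (0 : ℝ) < M := by linarith
  have first : ∀ s s' : ℕ → Fin 2, s ≠ s' → ∃ k, (∀ i < k, s i = s' i) ∧ s k ≠ s' k := by
    intro s s' h
    have h' : ∃ k, s k ≠ s' k := Function.ne_iff.1 h
    refine ⟨Nat.find h', fun i hi => ?_, Nat.find_spec h'⟩
    by_contra hc
    exact Nat.find_min h' hi hc
  have inj : Function.Injective x := by
    intro s s' h
    by_contra hne
    obtain ⟨k, hk, hk'⟩ := first s s' hne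
    have := hx s s' k hk hk'
    rw [h, sub_self, abs_zero] at this
    have : 0 < m / (M : ℝ) ^ (k + 1) := by positivity
    linarith
  -- Since `M ^ r = 2`, a separation of order `M ^ (-k)` between codes becomes `2 ^ (-k)`, which
  -- bounds the distance of their binary values. Decoding is therefore `r`-Hölder onto `[0, 1]`, and
  -- the dimension is at least `r`.
  set r : ℝ := Real.logb M 2 with hr
  have hr0 : 0 < r := Real.logb_pos hM1 one_lt_two
  have hMr : (M : ℝ) ^ r = 2 := Real.rpow_logb hM0 hM1.ne' two_pos
  let g : ℝ → ℝ := fun y => Real.ofDigits (Function.invFun x y)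
  have hg : ∀ s, g (x s) = Real.ofDigits s := fun s => by
    simp only [g, Function.leftInverse_invFun inj s]
  have hC0 : 0 ≤ ((M : ℝ) / m) ^ r := by positivity
  have hold : HolderOnWith (((M : ℝ) / m) ^ r).toNNReal r.toNNReal g (Set.range x) := by
    rintro _ ⟨s, rfl⟩ _ ⟨s', rfl⟩
    rw [hg, hg]
    by_cases hs : s = s'
    · simp [hs]
    obtain ⟨k, hk, hk'⟩ := first s s' hs
    have h1 := hx s s' k hk hk'
    have h2 := Real.abs_ofDigits_sub_ofDigits_le hk
    have h3 : |Real.ofDigits s - Real.ofDigits s'| ≤ ((M : ℝ) / m) ^ r * |x s - x s'| ^ r := by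
      rw [← Real.mul_rpow (by positivity) (abs_nonneg _)]
      refine h2.trans ?_
      have h4 : ((M : ℝ) ^ k)⁻¹ ≤ (M : ℝ) / m * |x s - x s'| := by
        refine le_trans (le_of_eq ?_) (mul_le_mul_of_nonneg_left h1 (by positivity))
        rw [pow_succ]; field_simp
      have h5 : (((2 : ℕ) : ℝ) ^ k)⁻¹ = (((M : ℝ) ^ k)⁻¹) ^ r := by
        rw [Real.inv_rpow (by positivity), ← Real.rpow_natCast (M : ℝ), ← Real.rpow_mul hM0.le,
          mul_comm, Real.rpow_mul hM0.le, hMr, Real.rpow_natCast, Nat.cast_ofNat]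
      rw [h5]
      exact Real.rpow_le_rpow (by positivity) h4 hr0.le
    rw [edist_dist, edist_dist, Real.dist_eq, Real.dist_eq]
    rw [Real.coe_toNNReal r hr0.le, ENNReal.ofReal_rpow_of_nonneg (abs_nonneg _) hr0.le]
    change _ ≤ ENNReal.ofReal _ * _
    rw [← ENNReal.ofReal_mul hC0]
    exact ENNReal.ofReal_le_ofReal h3
  have himg : Set.Icc (0 : ℝ) 1 ⊆ g '' Set.range x := by
    intro y hy
    obtain ⟨s, -, hs⟩ := Real.ofDigits_SurjOn (b := 2) one_lt_two hy
    exact ⟨x s, ⟨s, rfl⟩, (hg s).trans hs⟩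
  have h1 : dimH (Set.Icc (0 : ℝ) 1) = 1 := by
    rw [Real.dimH_of_nonempty_interior (by simp)]
    simp
  have h2 := (dimH_mono himg).trans (hold.dimH_image_le (Real.toNNReal_pos.2 hr0))
  rw [h1] at h2
  by_contra h0
  rw [not_lt, nonpos_iff_eq_zero] at h0
  rw [h0, ENNReal.zero_div] at h2
  exact absurd h2 (by simp)

/-- A tree of grid cells in which every cell has two non-adjacent children has a limit set of
positive Hausdorff dimension. -/
theorem dimH_pos_of_branching {M : ℕ} (hM : 2 ≤ M) (a : ℝ) {m : ℝ} (hm : 0 < m)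
    (G : ℕ → ℕ → Prop) (h0 : G 0 0)
    (hG : ∀ k i, G k i → ∃ p q, p / M = i ∧ q / M = i ∧ p + 2 ≤ q ∧ G (k + 1) p ∧ G (k + 1) q) :
    0 < dimH {x | ∀ k, ∃ i, G k i ∧ x ∈ gridCell M a m k i} := by
  have hM0 : (0 : ℝ) < M := by exact_mod_cast (by omega : 0 < M)
  choose! p q hp hq hpq hGp hGq using hG
  have good : ∀ s k, G k (branchIndex p q s k) := by
    intro s k
    induction k with
    | zero => exact h0
    | succ k ih =>
      simp only [branchIndex]
      split_ifs
      exacts [hGp k _ ih, hGq k _ ih]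
  have sub : ∀ s, Antitone fun k => gridCell M a m k (branchIndex p q s k) := by
    intro s
    refine antitone_nat_of_succ_le fun k => ?_
    have h : branchIndex p q s (k + 1) / M = branchIndex p q s k := by
      simp only [branchIndex]
      split_ifs
      exacts [hp k _ (good s k), hq k _ (good s k)]
    have := gridCell_succ_subset (by omega : 0 < M) (a := a) hm.le k (branchIndex p q s (k + 1))
    rwa [h] at this
  have ex : ∀ s, ∃ x, ∀ k, x ∈ gridCell M a m k (branchIndex p q s k) := by
    intro s
    have := ciSup_mem_iInter_Icc_of_antitone_Icc (sub s) fun k => by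
      have : 0 ≤ m / (M : ℝ) ^ k := by positivity
      nlinarith
    exact ⟨_, Set.mem_iInter.1 this⟩
  choose x hx using ex
  refine lt_of_lt_of_le (dimH_range_pos_of_separated hM hm x ?_) (dimH_mono ?_)
  · have key : ∀ s s' k, (∀ i < k, s i = s' i) → s k = 0 → s' k ≠ 0 →
        m / (M : ℝ) ^ (k + 1) ≤ x s' - x s := by
      intro s s' k h hs hs'
      have h1 := (hx s (k + 1)).2
      have h2 := (hx s' (k + 1)).1
      simp only [branchIndex, hs, if_true] at h1
      simp only [branchIndex, hs', if_false, ← branchIndex_congr p q h] at h2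
      have h3 : ((p k (branchIndex p q s k) : ℝ)) + 2 ≤ q k (branchIndex p q s k) := by
        exact_mod_cast hpq k _ (good s k)
      have h4 : 0 ≤ m / (M : ℝ) ^ (k + 1) := by positivity
      nlinarith [mul_le_mul_of_nonneg_right h3 h4]
    intro s s' k h hne
    by_cases hs : s k = 0
    · have := key s s' k h hs (fun h' => hne (hs.trans h'.symm))
      rw [abs_sub_comm]
      exact this.trans (le_abs_self _)
    · have hs' : s' k = 0 := by
        have := Fin.exists_fin_two.1 ⟨s k, rfl⟩
        omega
      exact (key s' s k (fun i hi => (h i hi).symm) hs' hs).trans (le_abs_self _)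
  · rintro _ ⟨s, rfl⟩ k
    exact ⟨_, good s k, hx s k⟩

/-! ### Contracting potentials on the base 4 tree. -/

/-- The cell `(k, i)` of the base `4` tree and all its ancestors have potential at most `η`. -/
def IsGoodCell (φ : ℕ → ℕ → ℝ) (η : ℝ) : ℕ → ℕ → Prop
  | 0, i => i = 0 ∧ φ 0 i ≤ η
  | k + 1, i => IsGoodCell φ η k (i / 4) ∧ φ (k + 1) i ≤ η

lemma IsGoodCell.le {φ : ℕ → ℕ → ℝ} {η : ℝ} {k i : ℕ} (h : IsGoodCell φ η k i) : φ k i ≤ η := by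
  cases k with
  | zero => exact h.2
  | succ k => exact h.2

lemma IsGoodCell.exists_ancestor {φ : ℕ → ℕ → ℝ} {η a m x : ℝ} (hm : 0 ≤ m) {k i : ℕ} (n : ℕ)
    (h : IsGoodCell φ η (k + n) i) (hx : x ∈ gridCell 4 a m (k + n) i) :
    ∃ j, IsGoodCell φ η k j ∧ x ∈ gridCell 4 a m k j := by
  induction n generalizing i with
  | zero => exact ⟨i, h, hx⟩
  | succ n ih => exact ih h.1 (gridCell_succ_subset (by norm_num) hm _ _ hx)

lemma sum_Ico_four_mul {R : Type*} [AddCommMonoid R] (F : ℕ → R) {p q : ℕ} (h : p ≤ q) :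
    ∑ j ∈ Finset.Ico (4 * p) (4 * q), F j =
      ∑ j ∈ Finset.Ico p q, ∑ d ∈ Finset.range 4, F (4 * j + d) := by
  induction q, h using Nat.le_induction with
  | base => simp
  | succ q hq ih =>
    rw [Finset.sum_Ico_succ_top hq, ← ih,
      ← Finset.sum_Ico_consecutive F (by omega : 4 * p ≤ 4 * q) (by omega : 4 * q ≤ 4 * (q + 1))]
    congr 1
    rw [Finset.sum_Ico_eq_sum_range]
    congr 2
    omega

open Classical in
/-- The good cells of level `k + n` below the cell `(k, i)`. -/
noncomputable def goodDescendants (φ : ℕ → ℕ → ℝ) (η : ℝ) (k i n : ℕ) : Finset ℕ :=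
  (Finset.Ico (4 ^ n * i) (4 ^ n * (i + 1))).filter (IsGoodCell φ η (k + n))

/-- The total slack `∑ (η - φ)` over good cells at least doubles per level. For one good parent the
bounds on `hφ` and `ε` leave a surplus of at least `(4w - 2)(η - φ)`, which is nonnegative because
`w ≥ 1/2`. The extra term starts the growth even when the slack of the first cell is zero. -/
lemma two_mul_sum_goodDescendants_le {φ : ℕ → ℕ → ℝ} {η w ε : ℝ}
    (hw : 1 / 2 ≤ w) (hε : ε ≤ (1 - w) * η / 2)
    (hφ : ∀ k i, ∑ d ∈ Finset.range 4, φ (k + 1) (4 * i + d) ≤ 4 * w * φ k i + 4 * ε)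
    (k i n : ℕ) :
    2 * ∑ j ∈ goodDescendants φ η k i n, (η - φ (k + n) j) +
      2 * (1 - w) * η * (goodDescendants φ η k i n).card ≤
      ∑ j ∈ goodDescendants φ η k i (n + 1), (η - φ (k + (n + 1)) j) := by
  classical
  have h1 : ∑ j ∈ goodDescendants φ η k i (n + 1), (η - φ (k + (n + 1)) j) =
      ∑ j ∈ Finset.Ico (4 ^ n * i) (4 ^ n * (i + 1)), ∑ d ∈ Finset.range 4,
        if IsGoodCell φ η (k + n + 1) (4 * j + d) then η - φ (k + n + 1) (4 * j + d) else 0 := by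
    rw [goodDescendants, Finset.sum_filter, pow_succ', mul_assoc, mul_assoc, sum_Ico_four_mul]
    · rfl
    · exact Nat.mul_le_mul_left _ (Nat.le_succ i)
  rw [h1, goodDescendants, Finset.sum_filter, Finset.card_filter, Nat.cast_sum, Finset.mul_sum,
    Finset.mul_sum, ← Finset.sum_add_distrib]
  refine Finset.sum_le_sum fun j _ => ?_
  have hdiv : ∀ d ∈ Finset.range 4, (4 * j + d) / 4 = j := by
    intro d hd
    have := Finset.mem_range.1 hd
    omega
  by_cases hj : IsGoodCell φ η (k + n) j
  · have h2 : ∀ d ∈ Finset.range 4, η - φ (k + n + 1) (4 * j + d) ≤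
        if IsGoodCell φ η (k + n + 1) (4 * j + d) then η - φ (k + n + 1) (4 * j + d) else 0 := by
      intro d hd
      split_ifs with hg
      · exact le_rfl
      · by_contra hc
        refine hg ⟨?_, by linarith⟩
        rwa [hdiv d hd]
    refine le_trans ?_ (Finset.sum_le_sum h2)
    rw [Finset.sum_sub_distrib]
    simp only [hj, if_true, Finset.sum_const, Finset.card_range, nsmul_eq_mul]
    have := hφ (k + n) j
    have := hj.le
    push_cast
    nlinarith
  · have h2 : ∀ d ∈ Finset.range 4,
        (if IsGoodCell φ η (k + n + 1) (4 * j + d) then η - φ (k + n + 1) (4 * j + d) else 0) = 0 := by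
      intro d hd
      rw [if_neg]
      rintro ⟨h, -⟩
      rw [hdiv d hd] at h
      exact hj h
    rw [Finset.sum_eq_zero h2]
    simp [hj]

lemma exists_two_le_of_three_le_card {s : Finset ℕ} (h : 3 ≤ s.card) :
    ∃ p ∈ s, ∃ q ∈ s, p + 2 ≤ q := by
  have hs : s.Nonempty := Finset.card_pos.1 (by omega)
  refine ⟨s.min' hs, s.min'_mem hs, s.max' hs, s.max'_mem hs, ?_⟩
  by_contra hc
  have hsub : s ⊆ Finset.Ico (s.min' hs) (s.min' hs + 2) := by
    intro x hx
    have h1 := s.min'_le x hx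
    have h2 := s.le_max' x hx
    rw [Finset.mem_Ico]
    omega
  have := Finset.card_le_card hsub
  rw [Nat.card_Ico] at this
  omega

/-- If the potential of the cells of the base `4` tree contracts on average, up to a small error,
then the points lying in cells of small potential at all levels form a set of positive Hausdorff
dimension. -/
theorem dimH_pos_of_potential (a : ℝ) {m : ℝ} (hm : 0 < m) {φ : ℕ → ℕ → ℝ} {η w ε : ℝ}
    (hη : 0 < η) (hw : 1 / 2 ≤ w) (hw1 : w < 1) (hε : ε ≤ (1 - w) * η / 2)
    (hpos : ∀ k i, 0 ≤ φ k i) (h0 : φ 0 0 ≤ η)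
    (hφ : ∀ k i, ∑ d ∈ Finset.range 4, φ (k + 1) (4 * i + d) ≤ 4 * w * φ k i + 4 * ε) :
    0 < dimH (Set.Icc a (a + m) ∩ {x | ∀ k, ∃ i, φ k i ≤ η ∧ x ∈ gridCell 4 a m k i}) := by
  classical
  have hW : ∀ k i, IsGoodCell φ η k i → ∀ n, 2 ^ n * (2 * (1 - w) * η) ≤
      ∑ j ∈ goodDescendants φ η k i (n + 1), (η - φ (k + (n + 1)) j) := by
    intro k i hg n
    induction n with
    | zero =>
      refine le_trans ?_ (two_mul_sum_goodDescendants_le hw hε hφ k i 0)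
      have : goodDescendants φ η k i 0 = {i} := by
        ext j
        simp only [goodDescendants, Finset.mem_filter, Finset.mem_Ico, Finset.mem_singleton,
          pow_zero, one_mul, add_zero]
        constructor
        · rintro ⟨h, -⟩
          omega
        · rintro rfl
          exact ⟨by omega, hg⟩
      rw [this]
      have := hg.le
      simp only [Finset.sum_singleton, Finset.card_singleton, add_zero]
      push_cast
      linarith
    | succ n ih =>
      refine le_trans ?_ (two_mul_sum_goodDescendants_le hw hε hφ k i (n + 1))
      have : 0 ≤ 2 * (1 - w) * η * ((goodDescendants φ η k i (n + 1)).card : ℝ) := by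
        have : 0 < 1 - w := by linarith
        positivity
      rw [pow_succ]
      linarith
  -- The slack exceeds `3η` at this depth, and each good cell carries at most `η` since `φ ≥ 0`; so
  -- there are at least three good descendants, two of them non-adjacent.
  obtain ⟨n, hn⟩ : ∃ n : ℕ, 3 / (2 * (1 - w)) < 2 ^ n := pow_unbounded_of_one_lt _ one_lt_two
  have hcard : ∀ k i, IsGoodCell φ η k i → 3 ≤ (goodDescendants φ η k i (n + 1)).card := by
    intro k i hg
    have h1 := hW k i hg n
    have h2 : ∑ j ∈ goodDescendants φ η k i (n + 1), (η - φ (k + (n + 1)) j) ≤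
        ∑ j ∈ goodDescendants φ η k i (n + 1), η :=
      Finset.sum_le_sum fun j _ => by linarith [hpos (k + (n + 1)) j]
    rw [Finset.sum_const, nsmul_eq_mul] at h2
    rw [div_lt_iff₀ (by linarith)] at hn
    have h3 : (3 : ℝ) * η ≤ (goodDescendants φ η k i (n + 1)).card * η := by nlinarith
    exact_mod_cast le_of_mul_le_mul_right h3 hη
  -- Grouping `n + 1` levels into one step turns the base 4 tree into a base `4 ^ (n + 1)` tree with
  -- two separated children at every node.
  have hdim := dimH_pos_of_branching (M := 4 ^ (n + 1)) (by
      calc 2 ≤ 4 ^ 1 := by norm_num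
        _ ≤ 4 ^ (n + 1) := Nat.pow_le_pow_right (by norm_num) (by omega)) a hm
    (fun k i => IsGoodCell φ η ((n + 1) * k) i) ⟨rfl, h0⟩ (by
      intro k i hg
      obtain ⟨p, hp, q, hq, hpq⟩ := exists_two_le_of_three_le_card (hcard _ _ hg)
      rw [goodDescendants, Finset.mem_filter, Finset.mem_Ico] at hp hq
      have key : ∀ x, 4 ^ (n + 1) * i ≤ x ∧ x < 4 ^ (n + 1) * (i + 1) → x / 4 ^ (n + 1) = i := by
        rintro x ⟨h1, h2⟩
        refine Nat.div_eq_of_lt_le ?_ ?_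
        · rwa [mul_comm]
        · rwa [mul_comm]
      exact ⟨p, q, key p hp.1, key q hq.1, hpq, hp.2, hq.2⟩)
  have hgood : ∀ x ∈ {x | ∀ k, ∃ i, IsGoodCell φ η ((n + 1) * k) i ∧
      x ∈ gridCell (4 ^ (n + 1)) a m k i}, ∀ k, ∃ j, IsGoodCell φ η k j ∧ x ∈ gridCell 4 a m k j := by
    intro x hx k
    obtain ⟨i, hi, hxi⟩ := hx k
    have hlev : (n + 1) * k = k + n * k := by ring
    have hcell : x ∈ gridCell 4 a m (k + n * k) i := by
      rw [← hlev]
      simpa only [gridCell, Nat.cast_pow, ← pow_mul] using hxi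
    rw [hlev] at hi
    exact hi.exists_ancestor hm.le _ hcell
  refine hdim.trans_le (dimH_mono fun x hx => ⟨?_, fun k => ?_⟩)
  · obtain ⟨j, ⟨rfl, -⟩, hxj⟩ := hgood x hx 0
    simpa [gridCell] using hxj
  · obtain ⟨j, hj, hxj⟩ := hgood x hx k
    exact ⟨j, hj.le, hxj⟩

/-! ### Endpoint counts and the potential of a separated family of intervals. -/

open Classical in
/-- The number of endpoints of the interval `(u, v)` in `[p, q]`, where `u` counts if it lies in
`[p, q)` and `v` if it lies in `(p, q]`. -/
noncomputable def endCount (p q u v : ℝ) : ℝ :=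
  ((if u < q then 1 else 0) - (if u < p then 1 else 0)) +
    ((if v ≤ q then 1 else 0) - (if v ≤ p then 1 else 0))

lemma endCount_nonneg {p q : ℝ} (h : p ≤ q) (u v : ℝ) : 0 ≤ endCount p q u v := by
  unfold endCount
  split_ifs <;> first | (exfalso; linarith) | norm_num

lemma endCount_le_two (p q u v : ℝ) : endCount p q u v ≤ 2 := by
  unfold endCount
  split_ifs <;> norm_num

lemma one_le_endCount {p q u v : ℝ} (_ : p ≤ q) (hu : p ≤ u ∧ u < q ∨ p < v ∧ v ≤ q) :
    1 ≤ endCount p q u v := by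
  unfold endCount
  rcases hu with ⟨h1, h2⟩ | ⟨h1, h2⟩ <;> split_ifs <;> first | (exfalso; linarith) | norm_num

lemma exists_mem_Icc_of_endCount_ne_zero {p q u v : ℝ} (h : p ≤ q) (hn : endCount p q u v ≠ 0) :
    ∃ e, (e = u ∨ e = v) ∧ e ∈ Set.Icc p q := by
  by_contra! hc
  have hu := hc u (Or.inl rfl)
  have hv := hc v (Or.inr rfl)
  rw [Set.mem_Icc, not_and_or, not_le, not_le] at hu hv
  apply hn
  unfold endCount
  rcases hu with hu | hu <;> rcases hv with hv | hv <;> split_ifs <;>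
    first | (exfalso; linarith) | norm_num

/-- Each indicator difference telescopes. This is what the half-open conventions are for: an
endpoint on the common boundary of two cells is counted once. -/
lemma sum_endCount (n : ℕ) (p h u v : ℝ) :
    ∑ d ∈ Finset.range n, endCount (p + d * h) (p + (d + 1) * h) u v =
      endCount p (p + n * h) u v := by
  classical
  have h1 := Finset.sum_range_sub (fun d : ℕ => if u < p + d * h then (1 : ℝ) else 0) n
  have h2 := Finset.sum_range_sub (fun d : ℕ => if v ≤ p + d * h then (1 : ℝ) else 0) n
  simp only [Nat.cast_add, Nat.cast_one, Nat.cast_zero, zero_mul, add_zero] at h1 h2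
  unfold endCount
  rw [Finset.sum_add_distrib, h1, h2]

section GapFamily

variable {ι Λ : Type*} {u v : ι → ℝ} {lab : ι → Λ} {θ : ℝ}

/-- Two intervals `(u g, v g)` with the same label have their endpoints at distance at least `θ`
times the length of the shorter one. -/
def EndsSeparated (u v : ι → ℝ) (lab : ι → Λ) (θ : ℝ) : Prop :=
  ∀ g g', lab g = lab g' → g ≠ g' → ∀ e e', (e = u g ∨ e = v g) → (e' = u g' ∨ e' = v g') →
    θ * min (v g - u g) (v g' - u g') ≤ |e - e'|

lemma EndsSeparated.eq (hsep : EndsSeparated u v lab θ) (hθ : 0 ≤ θ) {g g' : ι} {l e e' : ℝ}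
    (hlab : lab g = lab g') (he : e = u g ∨ e = v g) (he' : e' = u g' ∨ e' = v g')
    (hg : l < θ * (v g - u g)) (hg' : l < θ * (v g' - u g')) (hd : |e - e'| ≤ l) : g = g' := by
  by_contra hne
  have := hsep g g' hlab hne e e' he he'
  rw [mul_min_of_nonneg _ _ hθ] at this
  exact absurd (lt_min hg hg') (not_lt.2 (this.trans hd))

/-- A cell of length `l` contains endpoints of at most one interval per label among those with `θ|g|
> l`, and each interval has at most two endpoints. -/
lemma EndsSeparated.sum_endCount_le [Finite Λ] (hsep : EndsSeparated u v lab θ) (hθ : 0 ≤ θ)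
    {p l B : ℝ} (hl : 0 ≤ l) (T : Finset ι) (hT : ∀ g ∈ T, l < θ * (v g - u g)) {W : ι → ℝ}
    (hB : 0 ≤ B) (hWB : ∀ g ∈ T, W g ≤ B) :
    ∑ g ∈ T, endCount p (p + l) (u g) (v g) * W g ≤ 2 * Nat.card Λ * B := by
  classical
  have hpl : p ≤ p + l := by linarith
  have hcard : (T.filter fun g => endCount p (p + l) (u g) (v g) ≠ 0).card ≤ Nat.card Λ := by
    have : Fintype Λ := Fintype.ofFinite Λ
    rw [Nat.card_eq_fintype_card]
    refine Finset.card_le_card_of_injOn lab (fun _ _ => Finset.mem_univ _) ?_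
    intro g hg g' hg' hlab
    rw [Finset.mem_coe, Finset.mem_filter] at hg hg'
    obtain ⟨e, he, hep⟩ := exists_mem_Icc_of_endCount_ne_zero hpl hg.2
    obtain ⟨e', he', hep'⟩ := exists_mem_Icc_of_endCount_ne_zero hpl hg'.2
    refine hsep.eq hθ hlab he he' (hT g hg.1) (hT g' hg'.1) ?_
    rw [abs_sub_le_iff]
    constructor <;> linarith [hep.1, hep.2, hep'.1, hep'.2]
  calc ∑ g ∈ T, endCount p (p + l) (u g) (v g) * W g
      = ∑ g ∈ T.filter (fun g => endCount p (p + l) (u g) (v g) ≠ 0),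
          endCount p (p + l) (u g) (v g) * W g := by
        rw [Finset.sum_filter]
        refine Finset.sum_congr rfl fun g _ => ?_
        split_ifs with h
        · rfl
        · rw [not_not] at h
          rw [h, zero_mul]
    _ ≤ ∑ g ∈ T.filter (fun g => endCount p (p + l) (u g) (v g) ≠ 0), 2 * B := by
        refine Finset.sum_le_sum fun g hg => ?_
        exact (mul_le_mul_of_nonneg_left (hWB g (Finset.mem_filter.1 hg).1)
          (endCount_nonneg hpl _ _)).trans (mul_le_mul_of_nonneg_right (endCount_le_two _ _ _ _) hB)
    _ ≤ 2 * Nat.card Λ * B := by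
        rw [Finset.sum_const, nsmul_eq_mul]
        have : ((T.filter fun g => endCount p (p + l) (u g) (v g) ≠ 0).card : ℝ) ≤ Nat.card Λ := by
          exact_mod_cast hcard
        nlinarith

/-- The intervals of the family with an endpoint in `[a, a + m]` which are long compared with the
cells of level `k`. -/
def longGaps (u v : ι → ℝ) (θ a m : ℝ) (k : ℕ) : Set ι :=
  {g | (u g ∈ Set.Icc a (a + m) ∨ v g ∈ Set.Icc a (a + m)) ∧ m / 4 ^ k < θ * (v g - u g)}

/-- Two long intervals with the same label and chosen endpoints in the same mesh of size `m / 4 ^ k`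
coincide, and only finitely many meshes meet `[a, a + m]`. -/
lemma EndsSeparated.finite_longGaps [Finite Λ] (hsep : EndsSeparated u v lab θ) (hθ : 0 ≤ θ)
    (a : ℝ) {m : ℝ} (hm : 0 < m) (k : ℕ) : (longGaps u v θ a m k).Finite := by
  have hl : 0 < m / 4 ^ k := by positivity
  have hex : ∀ g ∈ longGaps u v θ a m k, ∃ e, (e = u g ∨ e = v g) ∧ e ∈ Set.Icc a (a + m) := by
    rintro g ⟨h | h, -⟩
    exacts [⟨_, Or.inl rfl, h⟩, ⟨_, Or.inr rfl, h⟩]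
  choose! e he hea using hex
  refine Set.Finite.of_injOn (f := fun g => (lab g, ⌊(e g - a) / (m / 4 ^ k)⌋))
    (t := Set.univ ×ˢ Set.Icc 0 ⌊m / (m / 4 ^ k)⌋) ?_ ?_ (Set.finite_univ.prod (Set.finite_Icc _ _))
  · intro g hg
    have := hea g hg
    refine ⟨Set.mem_univ _, Int.floor_nonneg.2 (div_nonneg (by linarith [this.1]) hl.le),
      Int.floor_le_floor ?_⟩
    gcongr
    linarith [this.2]
  · intro g hg g' hg' h
    obtain ⟨hlab, hfl⟩ := Prod.mk.inj h
    refine hsep.eq hθ hlab (he g hg) (he g' hg') hg.2 hg'.2 ?_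
    have := Int.abs_sub_lt_one_of_floor_eq_floor hfl
    rw [← sub_div, abs_div, abs_of_pos hl, div_lt_one hl, sub_sub_sub_cancel_right] at this
    exact this.le

/-- The potential of the cell `(k, i)`: every long gap contributes its relative length to the power
`c` for each of its endpoints in the cell. -/
noncomputable def gapPotential (u v : ι → ℝ) (a m c : ℝ) (S : ℕ → Finset ι) (k i : ℕ) : ℝ :=
  ∑ g ∈ S k, endCount (a + i * (m / 4 ^ k)) (a + i * (m / 4 ^ k) + m / 4 ^ k) (u g) (v g) *
    ((v g - u g) / (m / 4 ^ k)) ^ c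

lemma gapPotential_nonneg (huv : ∀ g, u g < v g) (a : ℝ) {m : ℝ} (hm : 0 < m) (c : ℝ)
    (S : ℕ → Finset ι) (k i : ℕ) : 0 ≤ gapPotential u v a m c S k i := by
  refine Finset.sum_nonneg fun g _ => ?_
  have hl : 0 < m / 4 ^ k := by positivity
  exact mul_nonneg (endCount_nonneg (by linarith) _ _)
    (Real.rpow_nonneg (div_nonneg (by linarith [huv g]) hl.le) _)

/-- Intervals already long at level `k` keep their endpoint count when summed over the children,
while each weight gains `4 ^ c`. An interval long only at level `k + 1` satisfies `θ|g| ≤ 4l`, so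
its weight is at most `(4 / θ) ^ c`. -/
lemma EndsSeparated.sum_gapPotential_le [Finite Λ] (hsep : EndsSeparated u v lab θ) (hθ : 0 < θ)
    (huv : ∀ g, u g < v g) (a : ℝ) {m : ℝ} (hm : 0 < m) {c : ℝ} (hc : 0 ≤ c)
    (S : ℕ → Finset ι) (hS : ∀ k g, g ∈ S k ↔ g ∈ longGaps u v θ a m k) (k i : ℕ) :
    ∑ d ∈ Finset.range 4, gapPotential u v a m c S (k + 1) (4 * i + d) ≤
      4 ^ c * gapPotential u v a m c S k i + 4 * (2 * Nat.card Λ * (4 / θ) ^ c) := by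
  classical
  set l : ℝ := m / 4 ^ (k + 1) with hl
  have hl0 : 0 < l := by positivity
  have hkl : m / 4 ^ k = 4 * l := by
    rw [hl, pow_succ]; field_simp
  have hsub : S k ⊆ S (k + 1) := by
    intro g hg
    rw [hS] at hg ⊢
    refine ⟨hg.1, lt_trans ?_ hg.2⟩
    rw [hkl, ← hl]
    linarith
  have hsplit : ∀ d : ℕ, gapPotential u v a m c S (k + 1) (4 * i + d) =
      ∑ g ∈ S (k + 1) \ S k, endCount (a + ((4 * i + d : ℕ) : ℝ) * l)
        (a + ((4 * i + d : ℕ) : ℝ) * l + l) (u g) (v g) * ((v g - u g) / l) ^ c +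
      ∑ g ∈ S k, endCount (a + i * (4 * l) + d * l) (a + i * (4 * l) + (d + 1) * l) (u g) (v g) *
        ((v g - u g) / l) ^ c := by
    intro d
    rw [gapPotential, ← Finset.sum_sdiff hsub]
    congr 1
    refine Finset.sum_congr rfl fun g _ => ?_
    congr 2 <;> push_cast <;> ring
  have hnew : ∀ d ∈ Finset.range 4, ∑ g ∈ S (k + 1) \ S k, endCount (a + ((4 * i + d : ℕ) : ℝ) * l)
      (a + ((4 * i + d : ℕ) : ℝ) * l + l) (u g) (v g) * ((v g - u g) / l) ^ c ≤
      2 * Nat.card Λ * (4 / θ) ^ c := by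
    intro d _
    refine hsep.sum_endCount_le hθ.le hl0.le _ (fun g hg => ?_) (by positivity) (fun g hg => ?_)
    · exact ((hS _ _).1 (Finset.mem_sdiff.1 hg).1).2
    · rw [Finset.mem_sdiff, hS, hS] at hg
      have h1 : θ * (v g - u g) ≤ 4 * l := by
        rw [← hkl]
        by_contra! h
        exact hg.2 ⟨hg.1.1, h⟩
      refine Real.rpow_le_rpow (div_nonneg (by linarith [huv g]) hl0.le) ?_ hc
      rw [div_le_div_iff₀ hl0 hθ]
      linarith
  have hold : ∑ d ∈ Finset.range 4, ∑ g ∈ S k,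
      endCount (a + i * (4 * l) + d * l) (a + i * (4 * l) + (d + 1) * l) (u g) (v g) *
        ((v g - u g) / l) ^ c = 4 ^ c * gapPotential u v a m c S k i := by
    rw [Finset.sum_comm, gapPotential, Finset.mul_sum, hkl]
    refine Finset.sum_congr rfl fun g _ => ?_
    rw [← Finset.sum_mul, sum_endCount]
    have h1 : (v g - u g) / l = 4 * ((v g - u g) / (4 * l)) := by field_simp
    rw [h1, Real.mul_rpow (by norm_num) (div_nonneg (by linarith [huv g]) (by linarith))]
    push_cast
    ring
  simp only [hsplit]
  rw [Finset.sum_add_distrib, hold, add_comm]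
  refine add_le_add_right ((Finset.sum_le_sum hnew).trans (le_of_eq ?_)) _
  simp

/-- If finitely many families of intervals have well separated endpoints and the intervals are short
enough, then their complement in `[a, a + m]` has positive Hausdorff dimension. -/
theorem EndsSeparated.dimH_diff_pos [Finite Λ] (hsep : EndsSeparated u v lab θ) (hθ : 4 < θ)
    (huv : ∀ g, u g < v g) (a : ℝ) {m L δ : ℝ} (hm : 0 < m) (hL : ∀ g, v g - u g ≤ L) (hLm : L < m)
    (hδ : 0 < δ) (hδ' : δ ≤ 1 / 2) (h0 : 2 * Nat.card Λ * (L / m) ^ (1 - δ) ≤ 1 / 8)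
    (h1 : 2 * Nat.card Λ * (4 / θ) ^ (1 - δ) ≤ (1 - 4 ^ (-δ)) / 16) :
    0 < dimH (Set.Icc a (a + m) \ ⋃ g, Set.Ioo (u g) (v g)) := by
  classical
  rcases isEmpty_or_nonempty ι with hι | ⟨⟨g₀⟩⟩
  · rw [Set.iUnion_of_empty, Set.sdiff_empty,
      Real.dimH_of_nonempty_interior (by rw [interior_Icc]; exact Set.nonempty_Ioo.2 (by linarith))]
    simp
  have hL0 : 0 ≤ L := by linarith [huv g₀, hL g₀]
  have hc : 0 ≤ 1 - δ := by linarith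
  have hθ0 : 0 < θ := by linarith
  let S : ℕ → Finset ι := fun k => (hsep.finite_longGaps hθ0.le a hm k).toFinset
  have hS : ∀ k g, g ∈ S k ↔ g ∈ longGaps u v θ a m k := fun k g => Set.Finite.mem_toFinset _
  have hw : (1 : ℝ) / 2 ≤ 4 ^ (-δ) := by
    have h2 : (4 : ℝ) ^ (-(1 / 2) : ℝ) = 1 / 2 := by
      rw [show (4 : ℝ) = 2 ^ (2 : ℝ) by norm_num, ← Real.rpow_mul (by norm_num)]
      norm_num [Real.rpow_neg_one]
    rw [← h2]
    exact Real.rpow_le_rpow_of_exponent_le (by norm_num) (by linarith)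
  have hw1 : (4 : ℝ) ^ (-δ) < 1 := Real.rpow_lt_one_of_one_lt_of_neg (by norm_num) (by linarith)
  have h4 : (4 : ℝ) ^ (1 - δ) = 4 * 4 ^ (-δ) := by
    rw [sub_eq_add_neg, Real.rpow_add (by norm_num), Real.rpow_one]
  -- Here `w = 4 ^ (-δ)`, and `ε = 2 * Nat.card Λ * (4 / θ) ^ (1 - δ)`; `h1` is exactly `ε ≤ (1 -
  -- w)η / 2` for `η = 1/8`.
  have hdim := dimH_pos_of_potential a hm (φ := gapPotential u v a m (1 - δ) S) (η := 1 / 8)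
    (by norm_num) hw hw1 (h1.trans (by linarith))
    (gapPotential_nonneg huv a hm _ S) (by
      refine le_trans (hsep.sum_endCount_le hθ0.le (by positivity) _
        (fun g hg => ((hS 0 g).1 hg).2) (B := (L / m) ^ (1 - δ)) (by positivity) fun g _ => ?_) h0
      rw [pow_zero, div_one]
      refine Real.rpow_le_rpow (div_nonneg (by linarith [huv g]) hm.le) ?_ hc
      gcongr
      exact hL g)
    (fun k i => by
      rw [← h4]
      exact hsep.sum_gapPotential_le hθ0 huv a hm hc S hS k i)
  refine hdim.trans_le (dimH_mono ?_)
  rintro x ⟨hxI, hx⟩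
  refine ⟨hxI, ?_⟩
  rw [Set.mem_iUnion]
  rintro ⟨g, hgu, hgv⟩
  have hlen : 0 < v g - u g := by linarith [huv g]
  -- At this level the cell is longer than the interval by a factor at most 4. Hence the cell around
  -- `x` has a counted endpoint, `θ > 4` makes the interval long, and its weight is at least `1/4`.
  obtain ⟨k, hk, hk'⟩ : ∃ k : ℕ, v g - u g < m / 4 ^ k ∧ m / 4 ^ (k + 1) ≤ v g - u g := by
    have hex : ∃ k : ℕ, m / 4 ^ k ≤ v g - u g := by
      obtain ⟨k, hk⟩ := pow_unbounded_of_one_lt (m / (v g - u g)) (by norm_num : (1 : ℝ) < 4)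
      refine ⟨k, ?_⟩
      rw [div_lt_iff₀ hlen] at hk
      rw [div_le_iff₀ (by positivity)]
      linarith
    obtain ⟨k, hk⟩ : ∃ k, Nat.find hex = k + 1 := by
      refine Nat.exists_eq_succ_of_ne_zero fun h => ?_
      have := Nat.find_spec hex
      rw [h, pow_zero, div_one] at this
      linarith [hL g]
    refine ⟨k, ?_, hk ▸ Nat.find_spec hex⟩
    rw [← not_le]
    exact Nat.find_min hex (by omega)
  have hl0 : 0 < m / 4 ^ k := by positivity
  have hkl : m / 4 ^ (k + 1) = m / 4 ^ k / 4 := by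
    rw [pow_succ]; field_simp
  rw [hkl] at hk'
  obtain ⟨i, hi, hxi⟩ := hx k
  have hxi1 : a + i * (m / 4 ^ k) ≤ x := by simpa using hxi.1
  have hxi2 : x ≤ a + i * (m / 4 ^ k) + m / 4 ^ k := by
    have := hxi.2
    push_cast at this
    linarith
  -- An interval containing a point of `[a, a + m]` and shorter than `m` has an endpoint there.
  have hgS : g ∈ S k := by
    rw [hS]
    refine ⟨?_, by nlinarith⟩
    have := hL g
    by_contra! hc
    have h2 := hc.1
    have h3 := hc.2
    rw [Set.mem_Icc, not_and_or] at h2 h3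
    rcases h2 with h2 | h2 <;> rcases h3 with h3 | h3 <;> linarith [hxI.1, hxI.2]
  have hends : 1 ≤ endCount (a + i * (m / 4 ^ k)) (a + i * (m / 4 ^ k) + m / 4 ^ k) (u g) (v g) := by
    refine one_le_endCount (by linarith) ?_
    by_cases hu : a + i * (m / 4 ^ k) ≤ u g
    · exact Or.inl ⟨hu, by linarith⟩
    · exact Or.inr ⟨by linarith, by linarith⟩
  have hterm : (1 : ℝ) / 4 ≤ ((v g - u g) / (m / 4 ^ k)) ^ (1 - δ) := by
    calc (1 : ℝ) / 4 = (1 / 4) ^ (1 : ℝ) := (Real.rpow_one _).symm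
      _ ≤ (1 / 4) ^ (1 - δ) :=
        Real.rpow_le_rpow_of_exponent_ge (by norm_num) (by norm_num) (by linarith)
      _ ≤ _ := by
        refine Real.rpow_le_rpow (by norm_num) ?_ hc
        rw [le_div_iff₀ hl0]
        linarith
  have hle := Finset.single_le_sum (f := fun g => endCount (a + i * (m / 4 ^ k))
    (a + i * (m / 4 ^ k) + m / 4 ^ k) (u g) (v g) * ((v g - u g) / (m / 4 ^ k)) ^ (1 - δ))
    (fun g _ => mul_nonneg (endCount_nonneg (by linarith) _ _)
      (Real.rpow_nonneg (div_nonneg (by linarith [huv g]) hl0.le) _)) hgS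
  have hφ : gapPotential u v a m (1 - δ) S k i ≤ 1 / 8 := hi
  unfold gapPotential at hφ
  nlinarith

end GapFamily

/-! ### Thickness as separation of gaps. -/

section Gaps

variable {C : Set ℝ}

lemma ordConnected_parentInterval (C : Set ℝ) (p q : ℝ) : (parentInterval C p q).OrdConnected :=
  isPreconnected_connectedComponentIn.ordConnected

lemma mid_mem_parentInterval {p q x : ℝ} (hx : x ∈ parentInterval C p q) :
    (p + q) / 2 ∈ parentInterval C p q :=
  mem_connectedComponentIn (connectedComponentIn_nonempty_iff.1 ⟨x, hx⟩)

lemma notMem_earlierGaps {p q x : ℝ} (hx : x ∈ parentInterval C p q) : x ∉ earlierGaps C p q :=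
  (connectedComponentIn_subset _ _ hx).2

/-- The parent interval is order-connected and contains the midpoint of its own gap, so reaching
left of `q` would force it to meet the removed gap `(p, q)`. -/
lemma parentInterval_subset_Ici {p q p' q' : ℝ} (hpq : p < q) (hp'q' : p' < q') (h : q ≤ p')
    (he : Set.Ioo p q ⊆ earlierGaps C p' q') : parentInterval C p' q' ⊆ Set.Ici q := by
  intro x hx
  by_contra hxq
  rw [Set.mem_Ici, not_le] at hxq
  have hy : max x ((p + q) / 2) ∈ parentInterval C p' q' :=
    (ordConnected_parentInterval C p' q').out hx (mid_mem_parentInterval hx)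
      ⟨le_max_left _ _, max_le (by linarith) (by linarith)⟩
  exact notMem_earlierGaps hy
    (he ⟨lt_of_lt_of_le (by linarith) (le_max_right _ _), max_lt hxq (by linarith)⟩)

lemma parentInterval_subset_Iic {p q p' q' : ℝ} (hpq : p < q) (hp'q' : p' < q') (h : q ≤ p')
    (he : Set.Ioo p' q' ⊆ earlierGaps C p q) : parentInterval C p q ⊆ Set.Iic p' := by
  intro x hx
  by_contra hxq
  rw [Set.mem_Iic, not_le] at hxq
  have hy : min x ((p' + q') / 2) ∈ parentInterval C p q :=
    (ordConnected_parentInterval C p q).out (mid_mem_parentInterval hx) hx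
      ⟨le_min (by linarith) (by linarith), min_le_left _ _⟩
  exact notMem_earlierGaps hy
    (he ⟨lt_min hxq (by linarith), lt_of_le_of_lt (min_le_right _ _) (by linarith)⟩)

lemma thickness_le (hC : ¬C.Subsingleton) {p q : ℝ} (h : IsGap C p q) :
    thickness C ≤ min (volume (leftPiece C p q)) (volume (rightPiece C p q)) /
      volume (Set.Ioo p q) := by
  rw [thickness, if_neg hC]
  exact (iInf_le _ p).trans ((iInf_le _ q).trans (iInf_le _ h))

lemma thickness_mul_le (hC : ¬C.Subsingleton) (hfin : thickness C ≠ ∞) {p q x y : ℝ}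
    (h : IsGap C p q) (hxy : x ≤ y)
    (hs : leftPiece C p q ⊆ Set.Icc x y ∨ rightPiece C p q ⊆ Set.Icc x y) :
    (thickness C).toReal * (q - p) ≤ y - x := by
  have hpq : 0 < q - p := by linarith [h.1]
  have h1 := thickness_le hC h
  have h2 : min (volume (leftPiece C p q)) (volume (rightPiece C p q)) ≤ ENNReal.ofReal (y - x) := by
    rw [← Real.volume_Icc]
    rcases hs with hs | hs
    · exact (min_le_left _ _).trans (measure_mono hs)
    · exact (min_le_right _ _).trans (measure_mono hs)
  rw [Real.volume_Ioo, ENNReal.le_div_iff_mul_le (Or.inl (by simpa using hpq))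
    (Or.inl ENNReal.ofReal_ne_top)] at h1
  have h3 := h1.trans h2
  rw [← ENNReal.ofReal_toReal hfin, ← ENNReal.ofReal_mul ENNReal.toReal_nonneg] at h3
  exact (ENNReal.ofReal_le_ofReal_iff (by linarith)).1 h3

/-- The gap listed later is no longer than the other one, and its piece facing the earlier gap is
trapped between the two. For equal lengths the left gap comes first. -/
lemma IsGap.thickness_mul_min_le (hC : ¬C.Subsingleton) (hfin : thickness C ≠ ∞) {p q p' q' : ℝ}
    (h : IsGap C p q) (h' : IsGap C p' q') (hqp : q ≤ p') :
    (thickness C).toReal * min (q - p) (q' - p') ≤ p' - q := by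
  rcases lt_or_ge (q - p) (q' - p') with hlt | hge
  · rw [min_eq_left hlt.le]
    refine thickness_mul_le hC hfin h hqp (Or.inr ?_)
    rintro x ⟨hx, hxq⟩
    exact ⟨hxq, parentInterval_subset_Iic h.1 h'.1 hqp
      (fun y hy => ⟨p', q', h', Or.inl hlt, hy⟩) hx⟩
  · rw [min_eq_right hge]
    refine thickness_mul_le hC hfin h' hqp (Or.inl ?_)
    rintro x ⟨hx, hxp⟩
    refine ⟨parentInterval_subset_Ici h.1 h'.1 hqp (fun y hy => ⟨p, q, h, ?_, hy⟩) hx, hxp⟩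
    rcases hge.lt_or_eq with hlt | heq
    · exact Or.inl hlt
    · exact Or.inr ⟨heq.symm, by linarith [h.1]⟩

lemma IsGap.le_or_le {p q p' q' : ℝ} (h : IsGap C p q) (h' : IsGap C p' q')
    (hne : p ≠ p' ∨ q ≠ q') : q ≤ p' ∨ q' ≤ p := by
  have out : ∀ {p q : ℝ}, IsGap C p q → ∀ x ∈ C, p < x → q ≤ x := by
    intro p q h x hx hpx
    by_contra! hxq
    exact Set.disjoint_left.1 h.2.2.2 ⟨hpx, hxq⟩ hx
  rcases lt_trichotomy p p' with hlt | rfl | hgt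
  · exact Or.inl (out h _ h'.2.1 hlt)
  · exact absurd (le_antisymm (out h _ h'.2.2.1 h'.1) (out h' _ h.2.2.1 h.1))
      (hne.resolve_left fun hp => hp rfl)
  · exact Or.inr (out h' _ h.2.1 hgt)

lemma IsGap.thickness_mul_min_le_abs_sub (hC : ¬C.Subsingleton) (hfin : thickness C ≠ ∞)
    {p q p' q' : ℝ} (h : IsGap C p q) (h' : IsGap C p' q') (hne : p ≠ p' ∨ q ≠ q') {e e' : ℝ}
    (he : e = p ∨ e = q) (he' : e' = p' ∨ e' = q') :
    (thickness C).toReal * min (q - p) (q' - p') ≤ |e - e'| := by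
  have hpq := h.1
  have hpq' := h'.1
  rcases h.le_or_le h' hne with hle | hle
  · have h1 := h.thickness_mul_min_le hC hfin h' hle
    rw [abs_sub_comm]
    refine le_trans ?_ (le_abs_self _)
    rcases he with rfl | rfl <;> rcases he' with rfl | rfl <;> linarith
  · have h1 := h'.thickness_mul_min_le hC hfin h hle
    rw [min_comm] at h1
    refine le_trans ?_ (le_abs_self _)
    rcases he with rfl | rfl <;> rcases he' with rfl | rfl <;> linarith

lemma IsGap.thickness_mul_length_le (hC : ¬C.Subsingleton) (hfin : thickness C ≠ ∞)
    {p q s r : ℝ} (hconv : convexHull ℝ C = Set.Icc s r) (h : IsGap C p q) :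
    (thickness C).toReal * (q - p) ≤ r - s := by
  have hp : p ∈ Set.Icc s r := hconv ▸ subset_convexHull ℝ C h.2.1
  refine thickness_mul_le hC hfin h (hp.1.trans hp.2) (Or.inl ?_)
  rintro x ⟨hx, -⟩
  rw [← hconv]
  exact (connectedComponentIn_subset _ _ hx).1

lemma not_subsingleton_of_convexHull_eq_Icc {s r : ℝ} (hsr : s < r)
    (hconv : convexHull ℝ C = Set.Icc s r) : ¬C.Subsingleton := by
  intro h
  have h1 : (convexHull ℝ C).Subsingleton := by
    rcases h.eq_empty_or_singleton with rfl | ⟨x, rfl⟩ <;> simp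
  rw [hconv] at h1
  exact hsr.ne (h1 ⟨le_rfl, hsr.le⟩ ⟨hsr.le, le_rfl⟩)

lemma exists_isGap_of_notMem {s r y : ℝ} (hC : IsCompact C) (hconv : convexHull ℝ C = Set.Icc s r)
    (hy : y ∈ Set.Icc s r) (hyC : y ∉ C) : ∃ p q, IsGap C p q ∧ y ∈ Set.Ioo p q := by
  have hle : ∃ x ∈ C, x ≤ y := by
    by_contra! h
    have : convexHull ℝ C ⊆ Set.Ioi y := convexHull_min h (convex_Ioi y)
    rw [hconv] at this
    exact lt_irrefl y (this hy)
  have hge : ∃ x ∈ C, y ≤ x := by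
    by_contra! h
    have : convexHull ℝ C ⊆ Set.Iio y := convexHull_min h (convex_Iio y)
    rw [hconv] at this
    exact lt_irrefl y (this hy)
  obtain ⟨x₁, hx₁, hx₁y⟩ := hle
  obtain ⟨x₂, hx₂, hx₂y⟩ := hge
  obtain ⟨p, ⟨hpC, hpy⟩, hp⟩ := (hC.inter_right isClosed_Iic).exists_isGreatest ⟨x₁, hx₁, hx₁y⟩
  obtain ⟨q, ⟨hqC, hqy⟩, hq⟩ := (hC.inter_right isClosed_Ici).exists_isLeast ⟨x₂, hx₂, hx₂y⟩
  have hpy' : p < y := lt_of_le_of_ne hpy fun h => hyC (h ▸ hpC)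
  have hqy' : y < q := lt_of_le_of_ne hqy fun h => hyC (h ▸ hqC)
  refine ⟨p, q, ⟨hpy'.trans hqy', hpC, hqC, Set.disjoint_left.2 fun z hz hzC => ?_⟩, hpy', hqy'⟩
  rcases le_total z y with h | h
  · exact absurd (hp ⟨hzC, h⟩) (not_le.2 hz.1)
  · exact absurd (hq ⟨hzC, h⟩) (not_le.2 hz.2)

lemma eq_Icc_of_thickness_eq_top {s r : ℝ} (hsr : s < r) (hC : IsCompact C)
    (hconv : convexHull ℝ C = Set.Icc s r) (h : thickness C = ∞) : C = Set.Icc s r := by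
  refine Set.Subset.antisymm (hconv ▸ subset_convexHull ℝ C) fun y hy => ?_
  by_contra hyC
  obtain ⟨p, q, hg, -⟩ := exists_isGap_of_notMem hC hconv hy hyC
  have h1 := thickness_le (not_subsingleton_of_convexHull_eq_Icc hsr hconv) hg
  rw [h, top_le_iff] at h1
  have h2 : volume (leftPiece C p q) ≤ volume (Set.Icc s r) := by
    refine measure_mono ?_
    rintro x ⟨hx, -⟩
    rw [← hconv]
    exact (connectedComponentIn_subset _ _ hx).1
  refine ENNReal.div_ne_top (ne_top_of_le_ne_top ?_ ((min_le_left _ _).trans h2)) ?_ h1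
  · rw [Real.volume_Icc]
    exact ENNReal.ofReal_ne_top
  · rw [Real.volume_Ioo]
    simpa using hg.1

end Gaps

/-! ### Pulling gaps back by bi-Lipschitz maps. -/

section BiLipschitz

variable {c₁ c₂ : ℝ} {f : ℝ → ℝ}

lemma IsBiLipschitz.continuous (hf : IsBiLipschitz c₁ c₂ f) : Continuous f := by
  refine (LipschitzWith.of_dist_le_mul (K := c₂.toNNReal) fun x y => ?_).continuous
  rw [Real.dist_eq, Real.dist_eq]
  refine (hf.2 x y).2.trans ?_
  gcongr
  exact Real.le_coe_toNNReal c₂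

lemma IsBiLipschitz.injective (hf : IsBiLipschitz c₁ c₂ f) : Function.Injective f := by
  intro x y h
  have h1 := (hf.2 x y).1
  rw [h, sub_self, abs_zero] at h1
  have h2 : |x - y| ≤ 0 := by
    by_contra! h3
    linarith [mul_pos hf.1 h3]
  exact sub_eq_zero.1 (abs_nonpos_iff.1 h2)

lemma IsBiLipschitz.neg (hf : IsBiLipschitz c₁ c₂ f) : IsBiLipschitz c₁ c₂ fun x => -f x := by
  refine ⟨hf.1, fun x y => ?_⟩
  rw [neg_sub_neg, abs_sub_comm (f y)]
  exact hf.2 x y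

lemma IsBiLipschitz.surjective_of_strictMono (hf : IsBiLipschitz c₁ c₂ f) (hm : StrictMono f) :
    Function.Surjective f := by
  refine hf.continuous.surjective ?_ ?_
  · have h : Filter.Tendsto (fun x => f 0 + c₁ * x) Filter.atTop Filter.atTop :=
      Filter.tendsto_atTop_add_const_left _ _ (Filter.tendsto_id.const_mul_atTop hf.1)
    refine Filter.tendsto_atTop_mono' _ ?_ h
    filter_upwards [Filter.eventually_ge_atTop 0] with x hx
    have := (hf.2 x 0).1
    rw [sub_zero, abs_of_nonneg hx, abs_of_nonneg (sub_nonneg.2 (hm.monotone hx))] at this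
    linarith
  · have h : Filter.Tendsto (fun x => f 0 + c₁ * x) Filter.atBot Filter.atBot :=
      Filter.tendsto_atBot_add_const_left _ _ (Filter.tendsto_id.const_mul_atBot hf.1)
    refine Filter.tendsto_atBot_mono' _ ?_ h
    filter_upwards [Filter.eventually_le_atBot 0] with x hx
    have := (hf.2 x 0).1
    rw [sub_zero, abs_of_nonpos hx, abs_of_nonpos (sub_nonpos.2 (hm.monotone hx))] at this
    linarith

lemma IsBiLipschitz.surjective (hf : IsBiLipschitz c₁ c₂ f) : Function.Surjective f := by
  rcases hf.continuous.strictMono_of_inj hf.injective with hm | hm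
  · exact hf.surjective_of_strictMono hm
  · intro y
    obtain ⟨x, hx⟩ := hf.neg.surjective_of_strictMono (fun x y h => neg_lt_neg (hm h)) (-y)
    exact ⟨x, neg_injective hx⟩

lemma IsBiLipschitz.exists_preimage_Ioo (hf : IsBiLipschitz c₁ c₂ f) {p q : ℝ} (hpq : p < q) :
    ∃ u v, u < v ∧ (f u = p ∧ f v = q ∨ f u = q ∧ f v = p) ∧ f ⁻¹' Set.Ioo p q ⊆ Set.Ioo u v := by
  obtain ⟨u, rfl⟩ := hf.surjective p
  obtain ⟨v, rfl⟩ := hf.surjective q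
  rcases hf.continuous.strictMono_of_inj hf.injective with hm | hm
  · exact ⟨u, v, hm.lt_iff_lt.1 hpq, Or.inl ⟨rfl, rfl⟩,
      fun x hx => ⟨hm.lt_iff_lt.1 hx.1, hm.lt_iff_lt.1 hx.2⟩⟩
  · exact ⟨v, u, hm.lt_iff_gt.1 hpq, Or.inr ⟨rfl, rfl⟩,
      fun x hx => ⟨hm.lt_iff_gt.1 hx.2, hm.lt_iff_gt.1 hx.1⟩⟩

end BiLipschitz

/-! ### Estimates from the choice of `N(τ)`. -/

section Numerics

lemma rpow_neg_one_sub_inv_log {T : ℝ} (hT : 1 < T) :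
    (1 / T) ^ (1 - 1 / Real.log T) = Real.exp 1 / T := by
  have hT0 : 0 < T := by linarith
  have hl : 0 < Real.log T := Real.log_pos hT
  rw [Real.rpow_def_of_pos (by positivity), one_div, Real.log_inv]
  have : -Real.log T * (1 - 1 / Real.log T) = 1 - Real.log T := by field_simp; ring
  rw [this, Real.exp_sub, Real.exp_log hT0]

/-- Combine `1 - β ^ δ ≤ δ |log β|` and `β ^ (1 - δ) ≤ √β` with `√β |log β| ≤ 2`. The resulting
order `δ` matches the lower bound for `1 - 4 ^ (-δ)`. -/
lemma rpow_mul_one_sub_rpow_le {β δ : ℝ} (hβ : 0 < β) (hβ1 : β ≤ 1) (hδ : 0 < δ)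
    (hδ' : δ ≤ 1 / 2) : β ^ (1 - δ) * (1 - β ^ δ) ≤ 2 * δ := by
  have h1 : 1 - β ^ δ ≤ δ * -Real.log β := by
    rw [Real.rpow_def_of_pos hβ]
    linarith [Real.add_one_le_exp (Real.log β * δ)]
  have h2 : β ^ (1 - δ) ≤ β ^ (1 / 2 : ℝ) :=
    Real.rpow_le_rpow_of_exponent_ge hβ hβ1 (by linarith)
  have hs : 0 < β ^ (1 / 2 : ℝ) := Real.rpow_pos_of_pos hβ _
  have h3 : β ^ (1 / 2 : ℝ) * -Real.log β ≤ 2 := by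
    have h4 := Real.add_one_le_exp (-Real.log (β ^ (1 / 2 : ℝ)))
    rw [Real.exp_neg, Real.exp_log hs, Real.log_rpow hβ] at h4
    have h5 : -Real.log β ≤ 2 * (β ^ (1 / 2 : ℝ))⁻¹ := by linarith
    calc β ^ (1 / 2 : ℝ) * -Real.log β ≤ β ^ (1 / 2 : ℝ) * (2 * (β ^ (1 / 2 : ℝ))⁻¹) := by gcongr
      _ = 2 := by field_simp
  have hlog : 0 ≤ -Real.log β := neg_nonneg.2 (Real.log_nonpos hβ.le hβ1)
  calc β ^ (1 - δ) * (1 - β ^ δ) ≤ β ^ (1 - δ) * (δ * -Real.log β) := by gcongr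
    _ ≤ β ^ (1 / 2 : ℝ) * (δ * -Real.log β) := by gcongr
    _ = δ * (β ^ (1 / 2 : ℝ) * -Real.log β) := by ring
    _ ≤ δ * 2 := by gcongr
    _ = 2 * δ := by ring

lemma half_le_one_sub_four_rpow_neg {δ : ℝ} (hδ : 0 < δ) (hδ' : δ ≤ 1) :
    δ / 2 ≤ 1 - 4 ^ (-δ) := by
  have hlog : 1 ≤ Real.log 4 := by
    rw [Real.le_log_iff_exp_le (by norm_num)]
    linarith [Real.exp_one_lt_d9]
  have h1 : 1 + δ ≤ (4 : ℝ) ^ δ := by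
    rw [Real.rpow_def_of_pos (by norm_num)]
    nlinarith [Real.add_one_le_exp (Real.log 4 * δ)]
  rw [Real.rpow_neg (by norm_num)]
  have h2 : ((4 : ℝ) ^ δ)⁻¹ ≤ (1 + δ)⁻¹ := inv_anti₀ (by linarith) h1
  have h3 : (1 + δ)⁻¹ ≤ 1 - δ / 2 := by
    rw [inv_le_iff_one_le_mul₀ (by linarith)]
    nlinarith
  linarith

lemma patternBound_estimates {A β τ x : ℝ} (hA : 1 ≤ A) (hβ : 0 < β) (hβ1 : β ≤ 1) (hτ : 0 < τ)
    (hT : Real.exp 1 ≤ τ * β) (hx1 : 1 ≤ x)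
    (hx : x ≤ τ * β / (720 ^ 2 * Real.exp 1 * A ^ (1 - 1 / Real.log (τ * β))) *
      (1 - β ^ (1 / Real.log (τ * β)))) :
    0 < 1 / Real.log (τ * β) ∧ 1 / Real.log (τ * β) ≤ 1 / 2 ∧
      2 * x * (1 / (τ * β)) ^ (1 - 1 / Real.log (τ * β)) ≤ 1 / 8 ∧
      2 * x * (4 / (τ / A)) ^ (1 - 1 / Real.log (τ * β)) ≤
        (1 - 4 ^ (-(1 / Real.log (τ * β)))) / 16 := by
  have hA0 : 0 < A := by linarith
  have hT0 : 0 < τ * β := by positivity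
  have he := Real.exp_one_gt_d9
  have he' := Real.exp_one_lt_d9
  have hT1 : 1 < τ * β := by linarith
  have hexp := rpow_neg_one_sub_inv_log hT1
  have hlog1 : 1 ≤ Real.log (τ * β) := (Real.le_log_iff_exp_le hT0).2 hT
  set δ := 1 / Real.log (τ * β) with hδ
  have hδ0 : 0 < δ := by positivity
  have hδ1 : δ ≤ 1 := by
    rw [hδ, div_le_one (by linarith)]
    exact hlog1
  have hAc : 1 ≤ A ^ (1 - δ) := Real.one_le_rpow hA (by linarith)
  have hb0 : 0 < β ^ δ := Real.rpow_pos_of_pos hβ _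
  have hb1 : β ^ δ ≤ 1 := Real.rpow_le_one hβ.le hβ1 hδ0.le
  have hden : 0 < 720 ^ 2 * Real.exp 1 * A ^ (1 - δ) := by positivity
  have hx2 : x * (720 ^ 2 * Real.exp 1 * A ^ (1 - δ)) ≤ τ * β * (1 - β ^ δ) := by
    rwa [div_mul_eq_mul_div, le_div_iff₀ hden] at hx
  have hx3 : x * A ^ (1 - δ) * (Real.exp 1 / (τ * β)) ≤ (1 - β ^ δ) / 720 ^ 2 := by
    rw [← mul_div_assoc, div_le_div_iff₀ hT0 (by norm_num)]
    linarith
  -- A bound that admits even one function already forces `τβ` to be huge, which yields `δ ≤ 1/2`.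
  have hTe : 720 ^ 2 * Real.exp 1 ≤ τ * β := by
    have h1 : 1 * (720 ^ 2 * Real.exp 1 * 1) ≤ x * (720 ^ 2 * Real.exp 1 * A ^ (1 - δ)) := by
      gcongr
    nlinarith
  have hlog2 : 2 ≤ Real.log (τ * β) := by
    rw [Real.le_log_iff_exp_le hT0, show (2 : ℝ) = 1 + 1 by norm_num, Real.exp_add]
    nlinarith
  have hδ2 : δ ≤ 1 / 2 := one_div_le_one_div_of_le two_pos hlog2
  refine ⟨hδ0, hδ2, ?_, ?_⟩
  · rw [hexp]
    have h1 : x * 1 * (Real.exp 1 / (τ * β)) ≤ x * A ^ (1 - δ) * (Real.exp 1 / (τ * β)) := by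
      gcongr
    linarith
  · have h1 : 4 / (τ / A) = 4 * A * β * (1 / (τ * β)) := by field_simp
    rw [h1, Real.mul_rpow (by positivity) (by positivity), Real.mul_rpow (by positivity) hβ.le,
      Real.mul_rpow (by norm_num) hA0.le, hexp]
    have h4 : (4 : ℝ) ^ (1 - δ) ≤ 4 := by
      calc (4 : ℝ) ^ (1 - δ) ≤ 4 ^ (1 : ℝ) :=
            Real.rpow_le_rpow_of_exponent_le (by norm_num) (by linarith)
        _ = 4 := Real.rpow_one _
    have h5 := rpow_mul_one_sub_rpow_le hβ hβ1 hδ0 hδ2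
    have h6 := half_le_one_sub_four_rpow_neg hδ0 hδ1
    have hβc : 0 < β ^ (1 - δ) := Real.rpow_pos_of_pos hβ _
    calc 2 * x * (4 ^ (1 - δ) * A ^ (1 - δ) * β ^ (1 - δ) * (Real.exp 1 / (τ * β)))
        = 2 * 4 ^ (1 - δ) * β ^ (1 - δ) * (x * A ^ (1 - δ) * (Real.exp 1 / (τ * β))) := by ring
      _ ≤ 2 * 4 * β ^ (1 - δ) * ((1 - β ^ δ) / 720 ^ 2) := by gcongr
      _ = 8 / 720 ^ 2 * (β ^ (1 - δ) * (1 - β ^ δ)) := by ring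
      _ ≤ 8 / 720 ^ 2 * (2 * δ) := by gcongr
      _ ≤ (1 - 4 ^ (-δ)) / 16 := by linarith

end Numerics

/-! ### Assembly. -/

theorem mainTheorem6 (A D m lam t : ℝ) (hA : 1 ≤ A) (hD : 0 < D) (hm : 0 < m) (hlam : 0 < lam)
    (F : Set (ℝ → ℝ)) (c₁ c₂ : (ℝ → ℝ) → ℝ)
    (hF : ∀ f ∈ F, IsBiLipschitz (c₁ f) (c₂ f) f ∧ c₂ f / c₁ f ≤ A ∧ lam * (c₁ f)⁻¹ ≤ D)
    (a b : ℝ) (hab : b - a = m)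
    (hI : Set.Icc a b ⊆ ⋂ f ∈ F, f ⁻¹' Set.Icc t (t + lam))
    (C : Set ℝ) (hC : IsCompact C) (hconv : convexHull ℝ C = Set.Icc t (t + lam))
    (hthick : ENNReal.ofReal (Real.exp 1) ≤ thickness C * ENNReal.ofReal (betaParam A D m))
    (F₀ : Set (ℝ → ℝ)) (hF₀ : F₀ ⊆ F)
    (hcard : F₀.encard ≤ patternBound A (betaParam A D m) (thickness C)) :
    0 < dimH (Set.Icc a b ∩
      ⋂ f ∈ F₀, f ⁻¹' (Set.Iio t ∪ C ∪ Set.Ioi (t + lam))) := by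
  have hb : b = a + m := by linarith
  subst hb
  have hIcc : dimH (Set.Icc a (a + m)) = 1 := by
    rw [Real.dimH_of_nonempty_interior (by rw [interior_Icc]; exact Set.nonempty_Ioo.2 (by linarith))]
    simp
  have hst : t < t + lam := by linarith
  have hCs := not_subsingleton_of_convexHull_eq_Icc hst hconv
  have hfI : ∀ f ∈ F₀, ∀ x ∈ Set.Icc a (a + m), f x ∈ Set.Icc t (t + lam) := fun f hf x hx =>
    Set.mem_iInter₂.1 (hI hx) f (hF₀ hf)
  -- Infinite thickness is treated apart because `toReal` sends it to `0`; then `C` has no gaps and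
  -- the whole interval survives.
  by_cases hfin : thickness C = ∞
  · refine lt_of_lt_of_le (by rw [hIcc]; exact one_pos) (dimH_mono (s := Set.Icc a (a + m)) ?_)
    refine fun x hx => ⟨hx, Set.mem_iInter₂.2 fun f hf => Or.inl (Or.inr ?_)⟩
    rw [eq_Icc_of_thickness_eq_top hst hC hconv hfin]
    exact hfI f hf x hx
  -- The numerical estimates need at least one function.
  rcases F₀.eq_empty_or_nonempty with rfl | hne
  · refine lt_of_lt_of_le (by rw [hIcc]; exact one_pos) (dimH_mono (s := Set.Icc a (a + m)) ?_)
    exact fun x hx => ⟨hx, by simp⟩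
  set β := betaParam A D m with hβdef
  have hβ : 0 < β := lt_min (by positivity) (by positivity)
  have hβD : β ≤ m / D := min_le_left _ _
  have hβA : β ≤ 1 / (4 * A) := min_le_right _ _
  have hβA' : β * (4 * A) ≤ 1 := (le_div_iff₀ (by positivity)).1 hβA
  set τ := (thickness C).toReal with hτdef
  have hT : Real.exp 1 ≤ τ * β := by
    rw [← ENNReal.ofReal_toReal hfin, ← ENNReal.ofReal_mul ENNReal.toReal_nonneg] at hthick
    exact (ENNReal.ofReal_le_ofReal_iff (by positivity)).1 hthick
  have he := Real.exp_one_gt_d9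
  have hτ : 0 < τ := pos_of_mul_pos_left (by linarith) hβ.le
  rw [patternBound, if_neg hfin] at hcard
  have hF₀fin : F₀.Finite := Set.finite_of_encard_le_coe hcard
  have : Finite F₀ := hF₀fin
  rw [← hF₀fin.cast_ncard_eq, Nat.cast_le, ← Nat.card_coe_set_eq] at hcard
  have hpos : 0 < Nat.card F₀ := by
    rw [Nat.card_coe_set_eq]
    exact (Set.ncard_pos hF₀fin).2 hne
  have hx := (Nat.le_floor_iff' hpos.ne').1 hcard
  obtain ⟨hδ, hδ', h0, h1⟩ := patternBound_estimates (x := Nat.card F₀) hA hβ (by nlinarith) hτ hT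
    (by exact_mod_cast hpos) hx
  let ι := {g : F₀ × ℝ × ℝ // IsGap C g.2.1 g.2.2}
  have hbl : ∀ f ∈ F₀, IsBiLipschitz (c₁ f) (c₂ f) f := fun f hf => (hF f (hF₀ hf)).1
  have hex : ∀ g : ι, ∃ u v, u < v ∧ ((g.1.1 : ℝ → ℝ) u = g.1.2.1 ∧ (g.1.1 : ℝ → ℝ) v = g.1.2.2 ∨
      (g.1.1 : ℝ → ℝ) u = g.1.2.2 ∧ (g.1.1 : ℝ → ℝ) v = g.1.2.1) ∧
      (g.1.1 : ℝ → ℝ) ⁻¹' Set.Ioo g.1.2.1 g.1.2.2 ⊆ Set.Ioo u v :=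
    fun g => (hbl _ g.1.1.2).exists_preimage_Ioo g.2.1
  choose u v huv hends hpre using hex
  have hlen : ∀ g : ι, c₁ g.1.1 * (v g - u g) ≤ g.1.2.2 - g.1.2.1 := by
    intro g
    have h2 := ((hbl _ g.1.1.2).2 (v g) (u g)).1
    rw [abs_of_pos (sub_pos.2 (huv g))] at h2
    have h3 := g.2.1
    rcases hends g with ⟨hu, hv⟩ | ⟨hu, hv⟩ <;> rw [hu, hv] at h2
    · rwa [abs_of_pos (sub_pos.2 h3)] at h2
    · rwa [abs_sub_comm, abs_of_pos (sub_pos.2 h3)] at h2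
  -- A gap has length at most `lam / τ`, so its preimage has length at most `lam / (c₁ τ) ≤ D / τ`,
  -- and `β ≤ m / D` turns this into `m / (τβ)`.
  have hL : ∀ g : ι, v g - u g ≤ 1 / (τ * β) * m := by
    intro g
    obtain ⟨hb, -, hD'⟩ := hF g.1.1 (hF₀ g.1.1.2)
    have hc := hb.1
    have h2 := g.2.thickness_mul_length_le hCs hfin hconv
    have h3 := hlen g
    have h4 : lam ≤ D * c₁ g.1.1 := by
      rwa [← div_eq_mul_inv, div_le_iff₀ hc] at hD'
    have h5 : β * D ≤ m := (le_div_iff₀ hD).1 hβD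
    have h6 : c₁ g.1.1 * (τ * (v g - u g)) ≤ c₁ g.1.1 * D := by
      nlinarith [mul_le_mul_of_nonneg_left h3 hτ.le]
    have h7 : τ * (v g - u g) ≤ D := le_of_mul_le_mul_left h6 hc
    rw [one_div_mul_eq_div, le_div_iff₀ (by positivity)]
    nlinarith [mul_le_mul_of_nonneg_left h7 hβ.le]
  have hsep : EndsSeparated u v (fun g : ι => g.1.1) (τ / A) := by
    intro g g' hlab hgg e e' he he'
    obtain ⟨hb, hA', -⟩ := hF g.1.1 (hF₀ g.1.1.2)
    have hc := hb.1
    have hlab' : g'.1.1 = g.1.1 := hlab.symm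
    have hends' := hends g'
    have hlen' := hlen g'
    rw [hlab'] at hends' hlen'
    have hpq : g.1.2.1 ≠ g'.1.2.1 ∨ g.1.2.2 ≠ g'.1.2.2 := by
      by_contra! h
      exact hgg (Subtype.ext (Prod.ext hlab (Prod.ext h.1 h.2)))
    have hfe : (g.1.1 : ℝ → ℝ) e = g.1.2.1 ∨ (g.1.1 : ℝ → ℝ) e = g.1.2.2 := by
      rcases he with rfl | rfl <;> rcases hends g with h | h <;> simp [h.1, h.2]
    have hfe' : (g.1.1 : ℝ → ℝ) e' = g'.1.2.1 ∨ (g.1.1 : ℝ → ℝ) e' = g'.1.2.2 := by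
      rcases he' with rfl | rfl <;> rcases hends' with h | h <;> simp [h.1, h.2]
    have h2 := g.2.thickness_mul_min_le_abs_sub hCs hfin g'.2 hpq hfe hfe'
    have h3 := (hb.2 e e').2
    have h4 : c₂ g.1.1 ≤ A * c₁ g.1.1 := (div_le_iff₀ hc).1 hA'
    have h5 : c₁ g.1.1 * min (v g - u g) (v g' - u g') ≤
        min (g.1.2.2 - g.1.2.1) (g'.1.2.2 - g'.1.2.1) := by
      rw [mul_min_of_nonneg _ _ hc.le]
      exact min_le_min (hlen g) hlen'
    have h6 : c₁ g.1.1 * (τ * min (v g - u g) (v g' - u g')) ≤ c₁ g.1.1 * (A * |e - e'|) := by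
      nlinarith [mul_le_mul_of_nonneg_left h5 hτ.le, mul_le_mul_of_nonneg_right h4 (abs_nonneg (e - e'))]
    rw [div_mul_eq_mul_div, div_le_iff₀ (by linarith)]
    linarith [le_of_mul_le_mul_left h6 hc]
  -- The term `1 / (4A)` in `β` serves here: `τ ≥ 4Aβτ ≥ 4Ae`.
  have hθ : 4 < τ / A := by
    rw [lt_div_iff₀ (by linarith)]
    nlinarith [mul_le_mul_of_nonneg_left hβA' hτ.le]
  refine (hsep.dimH_diff_pos hθ huv a hm hL ?_ hδ hδ' ?_ h1).trans_le (dimH_mono ?_)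
  · rw [one_div_mul_eq_div, div_lt_iff₀ (by positivity)]
    nlinarith
  · rwa [mul_div_cancel_right₀ _ hm.ne']
  · rintro x ⟨hxI, hx⟩
    refine ⟨hxI, Set.mem_iInter₂.2 fun f hf => Or.inl (Or.inr ?_)⟩
    by_contra hfx
    obtain ⟨p, q, hg, hpq⟩ := exists_isGap_of_notMem hC hconv (hfI f hf x hxI) hfx
    exact hx (Set.mem_iUnion.2 ⟨⟨(⟨f, hf⟩, p, q), hg⟩, hpre ⟨(⟨f, hf⟩, p, q), hg⟩ hpq⟩)
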